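/- Let $C_W>0$, $C_b\ge 0$, let $n_0,d\ge 1$, let $x^{(1)},\dots,x^{(d)}\in\mathbb R^{n_0}$, and let $\sigma:\mathbb R\to\mathbb R$ be Lipschitz with Lipschitz norm $\|\sigma\|_{\mathrm{Lip}}$. Let $b\sim\mathcal N(0,C_b)$ and let $W_1,\dots,W_{n_0}$ be i.i.d. real random variables, independent of $b$, with $\mathbb E[W_r]=0$ and $\mathbb E[W_r^2]=1$ (not necessarily Gaussian). Put $z(x)=b+\sqrt{C_W/n_0}\,\sum_{r=1}^{n_0}W_r x_r$ and define the limiting (NNGP) covariance matrices $K^{(\ell)}\in\mathbb R^{d\times d}$, $\ell\ge 2$, by $$K^{(2)}_{j,k}=C_b+C_W\,\mathbb E[\sigma(z(x^{(j)}))\sigma(z(x^{(k)}))],\qquad K^{(\ell)}_{j,k}=C_b+C_W\,\mathbb E\big[\sigma(G^{(\ell-1)}_1(x^{(j)}))\,\sigma(G^{(\ell-1)}_1(x^{(k)}))\big]\quad(\ell\ge 3),$$ where $(G^{(m)}_1(x^{(1)}),\dots,G^{(m)}_1(x^{(d)}))\sim\mathcal N_d(0,K^{(m)})$ for $m\ge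 2$. For a symmetric matrix $M$ let $\lambda(M)=\min_{\|y\|=1}y^{\top}My$ be its smallest eigenvalue. For $\ell\ge 3$ put $\hat K^{(\ell)}=K^{(\ell)}-C_b\mathbf 1_{d\times d}$, where $\mathbf 1_{d\times d}$ is the all-ones matrix, and $$D_\ell=\frac{C_W^{d(\ell-2)}}{d!}\,\lambda(K^{(2)})^d\sum_{\substack{k_1,\dots,k_d\in\{1,\dots,d\}\\ \text{pairwise distinct}}}\ \prod_{i=1}^d\ \prod_{r=1}^{\ell-2}\Big(\mathbb E\big[\sigma'(G^{(\ell-r)}_1(x^{(k_i)}))\big]\Big)^2 .$$ (If $\lambda(K^{(2)})>0$, then $\sigma'$ exists almost surely at all the Gaussian variables involved; if $\lambda(K^{(2)})=0$, then $D_\ell=0$.) The sum over tuples is the expanded form of the product $\prod_{i=1}^d\big(\sum_{k_i\notin\{k_1,\dots,k_{i-1}\}}\cdots\big)$, in which the range of each sum depends on the previous indices. Put also $$S_\ell=C_W\sum_{j=1}^d\mathbb E\big[\sigma(G^{(\ell-1)}_1(x^{(j)}))^2\big],\qquad T_\ell=(1+C_W)^2\big(1+(2C_W\|\sigma\|_{\mathrm{Lip}}^2)^{\ell-1}\big)\Big(d\,\ell\,(C_b+2|\sigma(0)|^2)+\frac1{n_0}\sum_{j=1}^d\|x^{(j)}\|^2\Big).$$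 Then for every $\ell\ge 3$: (a) $\det\hat K^{(\ell)}\ \ge\ D_\ell$; (b) $S_\ell^{\,d-1}\,\lambda(K^{(\ell)})\ge D_\ell$ and $T_\ell^{\,d-1}\,\lambda(K^{(\ell)})\ge D_\ell$; (c) if $\lambda(K^{(2)})>0$ and $\mathbb E[\sigma'(G^{(m)}_1(x^{(k)}))]\ne 0$ for all $2\le m\le\ell-1$ and $1\le k\le d$, then $D_\ell>0$, $\lambda(K^{(\ell)})\ge\lambda(\hat K^{(\ell)})>0$, and $$\frac1{\lambda(K^{(\ell)})}\le\frac1{\lambda(\hat K^{(\ell)})}\le\frac{(\operatorname{tr}\hat K^{(\ell)})^{d-1}}{\det\hat K^{(\ell)}}\le\frac{S_\ell^{\,d-1}}{D_\ell}\le\frac{T_\ell^{\,d-1}}{D_\ell}.$$ -/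

import Mathlib

open MeasureTheory ProbabilityTheory
open scoped NNReal

noncomputable section

/-- The first component of the first layer at the input `x`:
`z = b + (√C_W / √n₀) ∑ₖ Wₖ xₖ`. -/
def firstLayer {Ω : Type*} {n₀ : ℕ} (CW : ℝ) (b : Ω → ℝ) (W : Fin n₀ → Ω → ℝ)
    (x : EuclideanSpace ℝ (Fin n₀)) (ω : Ω) : ℝ :=
  b ω + Real.sqrt CW / Real.sqrt n₀ * ∑ k, W k ω * x k

/-- The matrix `K⁽²⁾`, with entries `C_b + C_W E[σ(z(xⱼ)) σ(z(xₖ))]`, where `z` is the first component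
of the (not necessarily Gaussian) first layer. -/
def secondCov {Ω : Type*} [MeasurableSpace Ω] (P : Measure Ω) {n₀ d : ℕ} (σ : ℝ → ℝ) (Cb CW : ℝ)
    (b : Ω → ℝ) (W : Fin n₀ → Ω → ℝ) (x : Fin d → EuclideanSpace ℝ (Fin n₀)) :
    Matrix (Fin d) (Fin d) ℝ :=
  Matrix.of fun j k =>
    Cb + CW * ∫ ω, σ (firstLayer CW b W (x j) ω) * σ (firstLayer CW b W (x k) ω) ∂P

/-- One step of the layer-wise recursion: the matrix with entries `C_b + C_W E[σ(Gⱼ) σ(Gₖ)]`,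
where `G` is a centered Gaussian vector with covariance `M`. -/
def covStep {d : ℕ} (σ : ℝ → ℝ) (Cb CW : ℝ) (M : Matrix (Fin d) (Fin d) ℝ) :
    Matrix (Fin d) (Fin d) ℝ :=
  Matrix.of fun j k => Cb + CW * ∫ g, σ (g j) * σ (g k) ∂(multivariateGaussian 0 M)

/-- The limiting covariance matrices `K⁽ℓ⁾`, `ℓ ≥ 2`, at the inputs `x`
(the values at `ℓ = 0, 1` are placeholders). -/
def limitCov {Ω : Type*} [MeasurableSpace Ω] (P : Measure Ω) {n₀ d : ℕ} (σ : ℝ → ℝ) (Cb CW : ℝ)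
    (b : Ω → ℝ) (W : Fin n₀ → Ω → ℝ) (x : Fin d → EuclideanSpace ℝ (Fin n₀)) :
    ℕ → Matrix (Fin d) (Fin d) ℝ
  | 0 => 0
  | 1 => 0
  | 2 => secondCov P σ Cb CW b W x
  | ℓ + 3 => covStep σ Cb CW (limitCov P σ Cb CW b W x (ℓ + 2))

/-- `K - C_b 𝟏`, where `𝟏` is the all-ones matrix. -/
def hatCov {d : ℕ} (Cb : ℝ) (K : Matrix (Fin d) (Fin d) ℝ) : Matrix (Fin d) (Fin d) ℝ :=
  K - Cb • Matrix.of fun _ _ => (1 : ℝ)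

/-- `λ(M) = min_{‖y‖ = 1} yᵀ M y` (Euclidean norm), the smallest eigenvalue of a symmetric `M`. -/
def minEigen {d : ℕ} (M : Matrix (Fin d) (Fin d) ℝ) : ℝ :=
  ⨅ y : Metric.sphere (0 : EuclideanSpace ℝ (Fin d)) 1,
    (y : EuclideanSpace ℝ (Fin d)).ofLp ⬝ᵥ M.mulVec (y : EuclideanSpace ℝ (Fin d)).ofLp

/-- The Lipschitz norm: the least Lipschitz constant of a Lipschitz function. -/
def lipNorm (σ : ℝ → ℝ) : ℝ≥0 := sInf {c : ℝ≥0 | LipschitzWith c σ}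

/-- `E[σ'(Gₖ)]` for a centered Gaussian vector `G` with covariance `M`. -/
def meanDeriv {d : ℕ} (σ : ℝ → ℝ) (M : Matrix (Fin d) (Fin d) ℝ) (k : Fin d) : ℝ :=
  ∫ g, deriv σ (g k) ∂(multivariateGaussian 0 M)

/-- `E[σ(Gₖ)²]` for a centered Gaussian vector `G` with covariance `M`. -/
def meanSq {d : ℕ} (σ : ℝ → ℝ) (M : Matrix (Fin d) (Fin d) ℝ) (k : Fin d) : ℝ :=
  ∫ g, σ (g k) ^ 2 ∂(multivariateGaussian 0 M)

/-- The lower bound on the determinant. The product over `i` of the sums over `kᵢ ∉ {k₁, …, kᵢ₋₁}`,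
whose ranges depend on the earlier indices, is the sum over all tuples `(k₁, …, k_d)` of
pairwise distinct indices of the product of the terms. -/
def detBound {d : ℕ} (σ : ℝ → ℝ) (CW : ℝ) (K : ℕ → Matrix (Fin d) (Fin d) ℝ) (ℓ : ℕ) : ℝ :=
  CW ^ (d * (ℓ - 2)) / (d.factorial : ℝ) * minEigen (K 2) ^ d *
    ∑ k : Fin d ↪ Fin d, ∏ i, ∏ r ∈ Finset.Icc 1 (ℓ - 2), meanDeriv σ (K (ℓ - r)) (k i) ^ 2

/-- The explicit upper bound on the trace of `K⁽ℓ⁾ - C_b 𝟏`. -/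
def traceBound {n₀ d : ℕ} (σ : ℝ → ℝ) (Cb CW : ℝ) (x : Fin d → EuclideanSpace ℝ (Fin n₀))
    (ℓ : ℕ) : ℝ :=
  (1 + CW) ^ 2 * (1 + (2 * CW * (lipNorm σ : ℝ) ^ 2) ^ (ℓ - 1)) *
    (d * ℓ * (Cb + 2 * |σ 0| ^ 2) + (∑ j, ‖x j‖ ^ 2) / n₀)

end

/-! Write `M` for the covariance of one layer and `m j` for `meanDeriv σ M j`. The quadratic form of
the next hatted matrix at `y` is `CW * E[F²]` with `F = ∑ y j σ(G j)`. Gaussian integration by parts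
shows that `V = ∑ m j y j G j` satisfies `E[F V] = E[V²]`, so `E[F²] ≥ E[V²]`, which is the form of
`M` at the rescaled vector `m j * y j` (`LipschitzWith.le_integral_sum_sq`). The rescaling is
diagonal, so iterating down to `K 2` bounds the hatted matrix below by a diagonal matrix
(`sum_prod_meanDeriv_le`). Comparing determinants gives the product of its entries, and this is
`detBound`, because the sum over tuples repeats one product `d!` times (`detBound_eq_prod`). For the
smallest eigenvalue, the determinant is at most that eigenvalue times `d - 1` factors bounded by the
trace. The trace obeys an affine recursion over the layers, which gives the explicit bound
`traceBound`. -/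

/-! ### Smallest eigenvalue, trace and determinant. -/

lemma minEigen_mul_le {d : ℕ} (M : Matrix (Fin d) (Fin d) ℝ) (y : Fin d → ℝ) :
    minEigen M * (y ⬝ᵥ y) ≤ y ⬝ᵥ M.mulVec y := by
  by_cases hy : y = 0
  · simp [hy]
  have hbdd : BddBelow (Set.range fun y : Metric.sphere (0 : EuclideanSpace ℝ (Fin d)) 1 =>
      (y : EuclideanSpace ℝ (Fin d)).ofLp ⬝ᵥ M.mulVec (y : EuclideanSpace ℝ (Fin d)).ofLp) := by
    have hc : Continuous fun y : Metric.sphere (0 : EuclideanSpace ℝ (Fin d)) 1 =>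
        (y : EuclideanSpace ℝ (Fin d)).ofLp ⬝ᵥ
          M.mulVec (y : EuclideanSpace ℝ (Fin d)).ofLp := by
      simp only [dotProduct, Matrix.mulVec]
      fun_prop
    exact (isCompact_range hc).bddBelow
  set v : EuclideanSpace ℝ (Fin d) := WithLp.toLp 2 y
  have hvy : ‖v‖ ^ 2 = y ⬝ᵥ y := by
    rw [EuclideanSpace.real_norm_sq_eq]
    simp [v, dotProduct, pow_two]
  have hv : ‖v‖ ≠ 0 := by
    rw [norm_ne_zero_iff]
    intro h
    exact hy (by simpa [v] using h)
  have hu : (‖v‖⁻¹ • v) ∈ Metric.sphere (0 : EuclideanSpace ℝ (Fin d)) 1 := by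
    simp [norm_smul, hv]
  have h := ciInf_le hbdd ⟨_, hu⟩
  change minEigen M ≤ _ at h
  simp only [WithLp.ofLp_smul, Matrix.mulVec_smul, smul_dotProduct, dotProduct_smul,
    smul_eq_mul, v] at h
  rw [← hvy]
  calc minEigen M * ‖v‖ ^ 2 ≤ (‖v‖⁻¹ * (‖v‖⁻¹ * (y ⬝ᵥ M.mulVec y))) * ‖v‖ ^ 2 := by gcongr
    _ = _ := by field_simp

lemma le_minEigen {d : ℕ} (hd : 0 < d) {M : Matrix (Fin d) (Fin d) ℝ} {c : ℝ}
    (h : ∀ y : Fin d → ℝ, c * (y ⬝ᵥ y) ≤ y ⬝ᵥ M.mulVec y) : c ≤ minEigen M := by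
  -- For `d = 0` the sphere is empty and the real infimum takes the default value 0; `hd` excludes
  -- this.
  have : NeZero d := ⟨hd.ne'⟩
  have : Nonempty (Metric.sphere (0 : EuclideanSpace ℝ (Fin d)) 1) :=
    ⟨⟨EuclideanSpace.single 0 1, by simp⟩⟩
  refine le_ciInf fun y => ?_
  have h1 : (y : EuclideanSpace ℝ (Fin d)).ofLp ⬝ᵥ (y : EuclideanSpace ℝ (Fin d)).ofLp = 1 := by
    have := EuclideanSpace.real_norm_sq_eq (y : EuclideanSpace ℝ (Fin d))
    rw [norm_eq_of_mem_sphere] at this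
    simp only [dotProduct, ← pow_two]
    linarith
  simpa [h1] using h (y : EuclideanSpace ℝ (Fin d)).ofLp

lemma posSemidef_of_dotProduct_nonneg {d : ℕ} {M : Matrix (Fin d) (Fin d) ℝ}
    (hM : M.IsHermitian) (h : ∀ y : Fin d → ℝ, 0 ≤ y ⬝ᵥ M.mulVec y) : M.PosSemidef :=
  Matrix.PosSemidef.of_dotProduct_mulVec_nonneg hM fun y => by simpa using h y

open scoped MatrixOrder in
lemma Matrix.IsHermitian.mul_dotProduct_le {d : ℕ} {M : Matrix (Fin d) (Fin d) ℝ}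
    (hM : M.IsHermitian) {c : ℝ} (hc : ∀ i, c ≤ hM.eigenvalues i) (y : Fin d → ℝ) :
    c * (y ⬝ᵥ y) ≤ y ⬝ᵥ M.mulVec y := by
  have h : algebraMap ℝ (Matrix (Fin d) (Fin d) ℝ) c ≤ M := by
    rw [algebraMap_le_iff_le_spectrum (ha := hM.isSelfAdjoint), hM.spectrum_real_eq_range_eigenvalues]
    rintro _ ⟨i, rfl⟩
    exact hc i
  have h2 := (Matrix.le_iff.1 h).dotProduct_mulVec_nonneg y
  simp only [Matrix.sub_mulVec, dotProduct_sub, star_trivial, Algebra.algebraMap_eq_smul_one,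
    Matrix.smul_mulVec, Matrix.one_mulVec, dotProduct_smul, smul_eq_mul] at h2
  linarith

/-- Split the least eigenvalue off the product; each of the other `d - 1` is nonnegative and at most
the sum of all. -/
lemma Matrix.PosSemidef.det_le_trace_pow_mul_minEigen {d : ℕ} (hd : 0 < d)
    {M : Matrix (Fin d) (Fin d) ℝ} (hM : M.PosSemidef) :
    M.det ≤ M.trace ^ (d - 1) * minEigen M := by
  have : NeZero d := ⟨hd.ne'⟩
  have h0 : ∀ i, 0 ≤ hM.1.eigenvalues i := hM.eigenvalues_nonneg
  obtain ⟨i, hi⟩ := Finite.exists_min hM.1.eigenvalues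
  have h1 : hM.1.eigenvalues i ≤ minEigen M := le_minEigen hd (hM.1.mul_dotProduct_le hi)
  have htr : M.trace = ∑ i, hM.1.eigenvalues i := by
    simpa using hM.1.trace_eq_sum_eigenvalues
  have hdet : M.det = ∏ i, hM.1.eigenvalues i := by
    simpa using hM.1.det_eq_prod_eigenvalues
  have htr0 : 0 ≤ M.trace := htr ▸ Finset.sum_nonneg fun i _ => h0 i
  rw [hdet, ← Finset.prod_erase_mul _ _ (Finset.mem_univ i)]
  have h2 : ∏ j ∈ Finset.univ.erase i, hM.1.eigenvalues j ≤ M.trace ^ (d - 1) := by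
    calc _ ≤ ∏ j ∈ Finset.univ.erase i, M.trace := by
          refine Finset.prod_le_prod (fun j _ => h0 j) fun j _ => ?_
          rw [htr]
          exact Finset.single_le_sum (fun j _ => h0 j) (Finset.mem_univ j)
      _ = _ := by simp
  exact mul_le_mul h2 h1 (h0 i) (by positivity)

/-- Congruence by `diag(e)⁻¹` turns the hypothesis into domination of the identity: all eigenvalues
are at least 1, hence so is the determinant. Undoing the congruence multiplies it by `(∏ e i)²`. -/
lemma Matrix.IsHermitian.prod_le_det {d : ℕ} {M : Matrix (Fin d) (Fin d) ℝ}
    (hM : M.IsHermitian) {e : Fin d → ℝ} (he : ∀ i, e i ≠ 0)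
    (h : ∀ y : Fin d → ℝ, ∑ i, e i ^ 2 * y i ^ 2 ≤ y ⬝ᵥ M.mulVec y) :
    ∏ i, e i ^ 2 ≤ M.det := by
  set E := Matrix.diagonal fun i => (e i)⁻¹
  have hE : E.transpose = E := Matrix.diagonal_transpose _
  have hB : (E * M * E).IsHermitian := by
    have := Matrix.isHermitian_mul_mul_conjTranspose E hM
    rwa [Matrix.conjTranspose_eq_transpose_of_trivial, hE] at this
  have hq : ∀ y : Fin d → ℝ, y ⬝ᵥ y ≤ y ⬝ᵥ (E * M * E).mulVec y := by
    intro y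
    have h1 := h (E.mulVec y)
    have h2 : y ⬝ᵥ (E * M * E).mulVec y = E.mulVec y ⬝ᵥ M.mulVec (E.mulVec y) := by
      rw [← Matrix.mulVec_mulVec, ← Matrix.mulVec_mulVec, Matrix.dotProduct_mulVec,
        ← Matrix.mulVec_transpose, hE]
    rw [h2]
    refine le_trans (le_of_eq ?_) h1
    refine Finset.sum_congr rfl fun i _ => ?_
    have := he i
    simp only [E, Matrix.mulVec_diagonal]
    field_simp
  have hev : ∀ i, 1 ≤ hB.eigenvalues i := by
    intro i
    rw [hB.eigenvalues_eq i]
    have h1 := hq (hB.eigenvectorBasis i).ofLp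
    have h2 : (hB.eigenvectorBasis i).ofLp ⬝ᵥ (hB.eigenvectorBasis i).ofLp = 1 := by
      have := EuclideanSpace.real_norm_sq_eq (hB.eigenvectorBasis i)
      rw [hB.eigenvectorBasis.norm_eq_one] at this
      simp only [dotProduct, ← pow_two]
      linarith
    simpa [h2] using h1
  have hdet : 1 ≤ (E * M * E).det := by
    have : (E * M * E).det = ∏ i, hB.eigenvalues i := by
      simpa using hB.det_eq_prod_eigenvalues
    rw [this]
    exact Finset.one_le_prod fun i _ => hev i
  rw [Matrix.det_mul, Matrix.det_mul, Matrix.det_diagonal, Finset.prod_inv_distrib] at hdet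
  have hp : (∏ i, e i) ≠ 0 := Finset.prod_ne_zero_iff.2 fun i _ => he i
  rw [Finset.prod_pow]
  calc (∏ i, e i) ^ 2 = (∏ i, e i) ^ 2 * 1 := (mul_one _).symm
    _ ≤ (∏ i, e i) ^ 2 * ((∏ i, e i)⁻¹ * M.det * (∏ i, e i)⁻¹) := by gcongr
    _ = M.det := by field_simp

/-! ### Lipschitz functions and one-dimensional Gaussian integration by parts. -/

lemma hasDerivAt_gaussianPDFReal {v : ℝ≥0} (hv : v ≠ 0) (t : ℝ) :
    HasDerivAt (gaussianPDFReal 0 v) (-(t / v) * gaussianPDFReal 0 v t) t := by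
  have hv' : (v : ℝ) ≠ 0 := by exact_mod_cast hv
  have h : HasDerivAt (fun x : ℝ => -(x - 0) ^ 2 / (2 * v)) (-(t / v)) t := by
    have := (((hasDerivAt_id' t).sub_const 0).fun_pow 2).fun_neg.div_const (2 * (v : ℝ))
    refine this.congr_deriv ?_
    simp only [sub_zero, Nat.cast_ofNat, Nat.add_one_sub_one, pow_one, mul_one]
    field_simp
  rw [gaussianPDFReal_def]
  exact (h.exp.const_mul (Real.sqrt (2 * Real.pi * v))⁻¹).congr_deriv (by ring)

lemma LipschitzWith.abs_le_add {c : ℝ≥0} {σ : ℝ → ℝ} (hσ : LipschitzWith c σ) (t : ℝ) :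
    |σ t| ≤ |σ 0| + c * |t| := by
  have h := hσ.dist_le_mul t 0
  simp only [Real.dist_eq, sub_zero] at h
  have := abs_add_le (σ 0) (σ t - σ 0)
  rw [add_sub_cancel] at this
  linarith

lemma LipschitzWith.memLp_comp {Ω : Type*} [MeasurableSpace Ω] {P : Measure Ω}
    [IsProbabilityMeasure P] {c : ℝ≥0} {σ : ℝ → ℝ} (hσ : LipschitzWith c σ) {X : Ω → ℝ}
    (hX : MemLp X 2 P) : MemLp (fun ω => σ (X ω)) 2 P := by
  refine MemLp.mono' (g := fun ω => |σ 0| + c * |X ω|) ?_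
    (hσ.continuous.comp_aestronglyMeasurable hX.1) (ae_of_all _ fun ω => hσ.abs_le_add _)
  have h1 : MemLp (fun _ : Ω => |σ 0|) 2 P := memLp_const _
  have h2 : MemLp (fun ω => (c : ℝ) * |X ω|) 2 P := hX.abs.const_mul _
  exact h1.add h2

lemma LipschitzWith.integral_sq_le {Ω : Type*} [MeasurableSpace Ω] {P : Measure Ω}
    [IsProbabilityMeasure P] {c : ℝ≥0} {σ : ℝ → ℝ} (hσ : LipschitzWith c σ) {X : Ω → ℝ}
    (hX : MemLp X 2 P) :
    ∫ ω, σ (X ω) ^ 2 ∂P ≤ 2 * σ 0 ^ 2 + 2 * c ^ 2 * ∫ ω, X ω ^ 2 ∂P := by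
  have hi := hX.integrable_sq.const_mul (2 * (c : ℝ) ^ 2)
  calc ∫ ω, σ (X ω) ^ 2 ∂P ≤ ∫ ω, (2 * σ 0 ^ 2 + 2 * c ^ 2 * X ω ^ 2) ∂P := by
        refine integral_mono (hσ.memLp_comp hX).integrable_sq
          ((integrable_const _).add hi) fun ω => ?_
        have h := pow_le_pow_left₀ (abs_nonneg _) (hσ.abs_le_add (X ω)) 2
        have h2 := add_sq_le (a := |σ 0|) (b := c * |X ω|)
        simp only [sq_abs, mul_pow] at h h2
        linarith
    _ = _ := by
        rw [integral_add (integrable_const _) hi, ← integral_const_mul]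
        simp

lemma integrable_mul_gaussianPDFReal {v : ℝ≥0} (hv : v ≠ 0) {f : ℝ → ℝ}
    (hf : Integrable f (gaussianReal 0 v)) :
    Integrable fun t => f t * gaussianPDFReal 0 v t := by
  rw [gaussianReal_of_var_ne_zero _ hv,
    integrable_withDensity_iff (measurable_gaussianPDF _ _) (by simp [gaussianPDF])] at hf
  simpa using hf

/-- Gaussian integration by parts for a Lipschitz function. -/
lemma LipschitzWith.integral_mul_self_gaussianReal {c : ℝ≥0} {σ : ℝ → ℝ}
    (hσ : LipschitzWith c σ) {v : ℝ≥0} (hv : v ≠ 0) :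
    ∫ t, σ t * t ∂gaussianReal 0 v = v * ∫ t, deriv σ t ∂gaussianReal 0 v := by
  have hv' : (v : ℝ) ≠ 0 := by exact_mod_cast hv
  set φ := gaussianPDFReal 0 v
  have hφd : ∀ t, deriv φ t = -(t / v) * φ t := fun t => (hasDerivAt_gaussianPDFReal hv t).deriv
  have hφc : ContDiff ℝ 1 φ := by
    have : φ = fun x : ℝ => (Real.sqrt (2 * Real.pi * v))⁻¹ * Real.exp (-(x - 0) ^ 2 / (2 * v)) :=
      gaussianPDFReal_def 0 v
    rw [this]
    fun_prop
  have hid : MemLp (fun t : ℝ => t) 2 (gaussianReal 0 v) := memLp_id_gaussianReal 2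
  have hσt : Integrable (fun t => σ t * t) (gaussianReal 0 v) :=
    (hσ.memLp_comp hid).integrable_mul hid
  have hσ' : Integrable (deriv σ) (gaussianReal 0 v) :=
    Integrable.of_bound (measurable_deriv σ).aestronglyMeasurable c
      (ae_of_all _ fun t => norm_deriv_le_of_lipschitz hσ)
  have i1 : Integrable fun t => deriv σ t * φ t := integrable_mul_gaussianPDFReal hv hσ'
  have i2 : Integrable fun t => σ t * deriv φ t := by
    have := (integrable_mul_gaussianPDFReal hv hσt).const_mul (-(v : ℝ)⁻¹)
    refine this.congr (ae_of_all _ fun t => ?_)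
    simp only [hφd, φ]
    field_simp
  have i3 : Integrable fun t => σ t * φ t :=
    integrable_mul_gaussianPDFReal hv ((hσ.memLp_comp hid).integrable one_le_two)
  -- `σ` need not be differentiable everywhere; absolute continuity suffices for integration by
  -- parts.
  have hparts : ∀ a b : ℝ, ∫ t in a..b, (deriv σ t * φ t + σ t * deriv φ t) =
      σ b * φ b - σ a * φ a := fun a b =>
    (hσ.lipschitzOnWith.absolutelyContinuousOnInterval).integral_deriv_mul_eq_sub
      (hφc.contDiffOn.absolutelyContinuousOnInterval)
  -- No decay estimate is needed: the boundary term converges, since the integrals over `[-r, r]`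
  -- do, and it is integrable in `r`, so its limit is 0.
  have hzero : ∫ t, (deriv σ t * φ t + σ t * deriv φ t) = 0 := by
    have key := intervalIntegral_tendsto_integral (i1.add i2) Filter.tendsto_neg_atTop_atBot
      Filter.tendsto_id
    have hI : Integrable fun r => σ r * φ r - σ (-r) * φ (-r) := i3.sub i3.comp_neg
    refine (hI.integrableAtFilter Filter.atTop).eq_zero_of_tendsto ?_ ?_
    · intro s hs
      obtain ⟨a, ha⟩ := Filter.mem_atTop_sets.1 hs
      refine top_unique (le_trans ?_ (measure_mono (show Set.Ici a ⊆ s from ha)))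
      simp
    · exact key.congr fun r => hparts (-r) r
  rw [integral_add i1 i2] at hzero
  rw [integral_gaussianReal_eq_integral_smul hv, integral_gaussianReal_eq_integral_smul hv]
  have e1 : ∫ t, gaussianPDFReal 0 v t • deriv σ t = ∫ t, deriv σ t * φ t := by
    simp only [smul_eq_mul, mul_comm, φ]
  have e2 : ∫ t, gaussianPDFReal 0 v t • (σ t * t) = -(v : ℝ) * ∫ t, σ t * deriv φ t := by
    rw [← integral_const_mul]
    refine integral_congr_ae (ae_of_all _ fun t => ?_)
    simp only [smul_eq_mul, hφd, φ]
    field_simp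
  rw [e1, e2]
  linear_combination -(v : ℝ) * hzero

/-! ### Quadratic forms of second moment matrices. -/

lemma integral_sum_mul_sum {Ω ι : Type*} [MeasurableSpace Ω] {P : Measure Ω} [Fintype ι]
    {X Y : ι → Ω → ℝ} (hX : ∀ i, MemLp (X i) 2 P) (hY : ∀ i, MemLp (Y i) 2 P) (u v : ι → ℝ) :
    ∫ ω, (∑ j, u j * X j ω) * (∑ k, v k * Y k ω) ∂P =
      u ⬝ᵥ (Matrix.of fun j k => ∫ ω, X j ω * Y k ω ∂P).mulVec v := by
  have hint : ∀ j k, Integrable (fun ω => X j ω * Y k ω) P :=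
    fun j k => (hX j).integrable_mul (hY k)
  have h1 : ∀ ω, (∑ j, u j * X j ω) * (∑ k, v k * Y k ω) =
      ∑ j, ∑ k, u j * v k * (X j ω * Y k ω) := by
    intro ω
    rw [Finset.sum_mul_sum]
    exact Finset.sum_congr rfl fun j _ => Finset.sum_congr rfl fun k _ => by ring
  simp only [h1]
  rw [integral_finsetSum _ fun j _ => integrable_finsetSum _ fun k _ => (hint j k).const_mul _]
  simp only [dotProduct, Matrix.mulVec, Matrix.of_apply, Finset.mul_sum]
  refine Finset.sum_congr rfl fun j _ => ?_
  rw [integral_finsetSum _ fun k _ => (hint j k).const_mul _]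
  refine Finset.sum_congr rfl fun k _ => ?_
  rw [integral_const_mul]
  ring

lemma memLp_two_sum_mul {Ω ι : Type*} [MeasurableSpace Ω] {P : Measure Ω} [Fintype ι]
    {X : ι → Ω → ℝ} (hX : ∀ i, MemLp (X i) 2 P) (u : ι → ℝ) :
    MemLp (fun ω => ∑ j, u j * X j ω) 2 P :=
  memLp_finsetSum _ fun j _ => (hX j).const_mul (u j)

/-- The quadratic form of a rescaled second moment matrix shifted by a constant. -/
lemma dotProduct_mulVec_add_const {Ω : Type*} [MeasurableSpace Ω] {P : Measure Ω} {d : ℕ}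
    {X : Fin d → Ω → ℝ} (hX : ∀ i, MemLp (X i) 2 P) (a c : ℝ) (y : Fin d → ℝ) :
    y ⬝ᵥ (Matrix.of fun j k => a + c * ∫ ω, X j ω * X k ω ∂P).mulVec y =
      a * (∑ j, y j) ^ 2 + c * ∫ ω, (∑ j, y j * X j ω) ^ 2 ∂P := by
  simp only [pow_two]
  rw [integral_sum_mul_sum hX hX, Finset.sum_mul_sum]
  simp only [dotProduct, Matrix.mulVec, Matrix.of_apply, Finset.mul_sum]
  rw [← Finset.sum_add_distrib]
  refine Finset.sum_congr rfl fun j _ => ?_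
  rw [← Finset.sum_add_distrib]
  exact Finset.sum_congr rfl fun k _ => by ring

lemma posSemidef_add_const {Ω : Type*} [MeasurableSpace Ω] {P : Measure Ω} {d : ℕ}
    {X : Fin d → Ω → ℝ} (hX : ∀ i, MemLp (X i) 2 P) {a c : ℝ} (ha : 0 ≤ a) (hc : 0 ≤ c) :
    (Matrix.of fun j k => a + c * ∫ ω, X j ω * X k ω ∂P).PosSemidef := by
  refine posSemidef_of_dotProduct_nonneg ?_ fun y => ?_
  · ext j k
    simp [mul_comm]
  · rw [dotProduct_mulVec_add_const hX]
    have : 0 ≤ ∫ ω, (∑ j, y j * X j ω) ^ 2 ∂P := integral_nonneg fun ω => sq_nonneg _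
    positivity

/-! ### Gaussian vectors and the one-layer lower bound. -/

section Gaussian

variable {d : ℕ} {M : Matrix (Fin d) (Fin d) ℝ}

lemma memLp_eval_multivariateGaussian (M : Matrix (Fin d) (Fin d) ℝ) (i : Fin d) :
    MemLp (fun g : EuclideanSpace ℝ (Fin d) => g i) 2 (multivariateGaussian 0 M) :=
  ((IsGaussian.hasGaussianLaw_id (μ := multivariateGaussian 0 M)).map_fun
    (EuclideanSpace.proj (𝕜 := ℝ) i)).memLp_two

lemma integral_eval_multivariateGaussian (M : Matrix (Fin d) (Fin d) ℝ) (i : Fin d) :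
    ∫ g, g i ∂(multivariateGaussian 0 M) = 0 := by
  have h := (EuclideanSpace.proj (𝕜 := ℝ) i).integral_comp_id_comm
    (IsGaussian.integrable_id (μ := multivariateGaussian 0 M))
  simpa using h

lemma integral_eval_mul_eval_multivariateGaussian (hM : M.PosSemidef) (i j : Fin d) :
    ∫ g, g i * g j ∂(multivariateGaussian 0 M) = M i j := by
  have h := covariance_eval_multivariateGaussian (μ := 0) hM i j
  rw [covariance_eq_sub (memLp_eval_multivariateGaussian M i)
    (memLp_eval_multivariateGaussian M j)] at h
  simpa [integral_eval_multivariateGaussian] using h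

/-- A Gaussian coordinate of variance 0 vanishes almost surely, so its covariances vanish. -/
lemma Matrix.PosSemidef.eq_zero_of_diag_eq_zero (hM : M.PosSemidef) {i j : Fin d}
    (hj : M j j = 0) : M i j = 0 := by
  have hX := memLp_eval_multivariateGaussian M
  have h0 : (fun g : EuclideanSpace ℝ (Fin d) => g j * g j) =ᵐ[multivariateGaussian 0 M] 0 := by
    rw [← integral_eq_zero_iff_of_nonneg (fun g => mul_self_nonneg _)
      ((hX j).integrable_mul (hX j)), integral_eval_mul_eval_multivariateGaussian hM, hj]
  rw [← integral_eval_mul_eval_multivariateGaussian hM]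
  refine integral_eq_zero_of_ae ?_
  filter_upwards [h0] with g hg
  simp [mul_self_eq_zero.1 hg]

/-- Gaussian integration by parts for a Lipschitz function of one coordinate. -/
lemma LipschitzWith.integral_mul_eval_multivariateGaussian {c : ℝ≥0} {σ : ℝ → ℝ}
    (hσ : LipschitzWith c σ) (hM : M.PosSemidef) (i j : Fin d) :
    ∫ g, σ (g j) * g i ∂(multivariateGaussian 0 M) = M j i * meanDeriv σ M j := by
  set μ := multivariateGaussian 0 M
  have hX := memLp_eval_multivariateGaussian M
  have hmp := measurePreserving_eval_multivariateGaussian (μ := 0) hM (i := j)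
  have hlaw : HasLaw (fun g : EuclideanSpace ℝ (Fin d) => g j)
      (gaussianReal 0 (M j j).toNNReal) μ := ⟨hmp.measurable.aemeasurable, hmp.map_eq⟩
  have hdiag : 0 ≤ M j j := hM.diag_nonneg
  have hone : ∫ g, σ (g j) * g j ∂μ = M j j * meanDeriv σ M j := by
    have h1 := hlaw.integral_comp (f := fun t => σ t * t)
      (hσ.continuous.mul continuous_id).aestronglyMeasurable
    have h2 := hlaw.integral_comp (f := deriv σ) (measurable_deriv σ).aestronglyMeasurable
    simp only [Function.comp_def] at h1 h2
    rw [h1, meanDeriv, h2]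
    -- In the degenerate case both sides are 0, whatever `deriv σ 0` is.
    by_cases hv : (M j j).toNNReal = 0
    · have : M j j = 0 := le_antisymm (Real.toNNReal_eq_zero.1 hv) hdiag
      simp [this]
    · rw [hσ.integral_mul_self_gaussianReal hv, Real.coe_toNNReal _ hdiag]
  -- `r` is the regression coefficient of `G i` on `G j`: the residual `G i - r G j` is uncorrelated
  -- with `G j`, hence independent of it by joint Gaussianity.
  obtain ⟨r, hr⟩ : ∃ r, M j i = r * M j j := by
    by_cases h0 : M j j = 0
    · refine ⟨0, ?_⟩
      rw [zero_mul]
      have := hM.1.apply j i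
      simp only [star_trivial] at this
      rw [← this]
      exact hM.eq_zero_of_diag_eq_zero h0
    · exact ⟨M j i / M j j, by field_simp⟩
  have hgauss : HasGaussianLaw (fun g : EuclideanSpace ℝ (Fin d) => (g j, g i - r * g j)) μ :=
    (IsGaussian.hasGaussianLaw_id (μ := μ)).map_fun
      ((EuclideanSpace.proj (𝕜 := ℝ) j).prod
        (EuclideanSpace.proj (𝕜 := ℝ) i - r • EuclideanSpace.proj (𝕜 := ℝ) j))
  have hR : MemLp (fun g : EuclideanSpace ℝ (Fin d) => g i - r * g j) 2 μ :=
    (hX i).sub ((hX j).const_mul r)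
  have hR0 : ∫ g, (g i - r * g j) ∂μ = 0 := by
    rw [integral_sub ((hX i).integrable one_le_two)
      (((hX j).integrable one_le_two).const_mul r), integral_const_mul]
    simp [integral_eval_multivariateGaussian]
  have hcov : cov[fun g : EuclideanSpace ℝ (Fin d) => g j, fun g => g i - r * g j; μ] = 0 := by
    rw [covariance_fun_sub_right (hX j) (hX i) ((hX j).const_mul r), covariance_const_mul_right,
      covariance_eval_multivariateGaussian hM, covariance_eval_multivariateGaussian hM, hr]
    ring
  have hind := (hgauss.indepFun_of_covariance_eq_zero hcov).comp hσ.continuous.measurable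
    measurable_id
  have hσX := hσ.memLp_comp (hX j)
  have hprod : ∫ g, σ (g j) * (g i - r * g j) ∂μ = 0 := by
    have := hind.integral_fun_mul_eq_mul_integral hσX.1 hR.1
    simp only [Function.comp_def, id_eq] at this
    rw [this, hR0, mul_zero]
  have hsplit : ∀ g : EuclideanSpace ℝ (Fin d),
      σ (g j) * g i = σ (g j) * (g i - r * g j) + r * (σ (g j) * g j) := fun g => by ring
  simp only [hsplit]
  have hi1 : Integrable (fun g : EuclideanSpace ℝ (Fin d) => σ (g j) * (g i - r * g j)) μ :=
    hσX.integrable_mul hR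
  have hi2 : Integrable (fun g : EuclideanSpace ℝ (Fin d) => r * (σ (g j) * g j)) μ :=
    (hσX.integrable_mul (hX j)).const_mul r
  rw [integral_add hi1 hi2, integral_const_mul, hprod, hone, hr]
  ring

/-- Projecting `∑ yⱼ σ(Gⱼ)` onto the linear functions of `G` bounds its second moment below. -/
lemma LipschitzWith.le_integral_sum_sq {c : ℝ≥0} {σ : ℝ → ℝ}
    (hσ : LipschitzWith c σ) (hM : M.PosSemidef) (y : Fin d → ℝ) :
    (fun j => meanDeriv σ M j * y j) ⬝ᵥ M.mulVec (fun j => meanDeriv σ M j * y j) ≤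
      ∫ g, (∑ j, y j * σ (g j)) ^ 2 ∂(multivariateGaussian 0 M) := by
  set μ := multivariateGaussian 0 M
  set w : Fin d → ℝ := fun j => meanDeriv σ M j * y j
  have hX := memLp_eval_multivariateGaussian M
  have hσX := fun j => hσ.memLp_comp (hX j)
  have hF := memLp_two_sum_mul hσX y
  have hV := memLp_two_sum_mul hX w
  have hFV : ∫ g, (∑ j, y j * σ (g j)) * (∑ k, w k * g k) ∂μ = w ⬝ᵥ M.mulVec w := by
    rw [integral_sum_mul_sum hσX hX]
    simp only [dotProduct, Matrix.mulVec, Matrix.of_apply, Finset.mul_sum,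
      hσ.integral_mul_eval_multivariateGaussian hM]
    exact Finset.sum_congr rfl fun j _ => Finset.sum_congr rfl fun k _ => by simp only [w]; ring
  have hVV : ∫ g, (∑ j, w j * g j) * (∑ k, w k * g k) ∂μ = w ⬝ᵥ M.mulVec w := by
    rw [integral_sum_mul_sum hX hX]
    simp only [integral_eval_mul_eval_multivariateGaussian hM]
    rfl
  -- Since `E[F V] = E[V²]`, expanding `E[(F - V)²] ≥ 0` leaves `E[F²] ≥ E[V²]`; `M` need not be
  -- invertible.
  have hnn : 0 ≤ ∫ g, (∑ j, y j * σ (g j) - ∑ j, w j * g j) ^ 2 ∂μ :=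
    integral_nonneg fun g => sq_nonneg _
  have hexp : ∀ g : EuclideanSpace ℝ (Fin d), (∑ j, y j * σ (g j) - ∑ j, w j * g j) ^ 2 =
      (∑ j, y j * σ (g j)) ^ 2 - 2 * ((∑ j, y j * σ (g j)) * ∑ j, w j * g j) +
        (∑ j, w j * g j) * ∑ j, w j * g j := fun g => by ring
  have hi1 := hF.integrable_sq
  have hi2 : Integrable (fun g : EuclideanSpace ℝ (Fin d) =>
      2 * ((∑ j, y j * σ (g j)) * ∑ j, w j * g j)) μ := (hF.integrable_mul hV).const_mul 2
  have hi3 : Integrable (fun g : EuclideanSpace ℝ (Fin d) =>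
      (∑ j, w j * g j) * ∑ j, w j * g j) μ := hV.integrable_mul hV
  have hi12 : Integrable (fun g : EuclideanSpace ℝ (Fin d) => (∑ j, y j * σ (g j)) ^ 2 -
      2 * ((∑ j, y j * σ (g j)) * ∑ j, w j * g j)) μ := hi1.sub hi2
  simp only [hexp] at hnn
  rw [integral_add hi12 hi3, integral_sub hi1 hi2, integral_const_mul, hFV, hVV] at hnn
  linarith

variable {c : ℝ≥0} {σ : ℝ → ℝ} {Cb CW : ℝ}

lemma posSemidef_covStep (hσ : LipschitzWith c σ) (hCb : 0 ≤ Cb) (hCW : 0 ≤ CW) :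
    (covStep σ Cb CW M).PosSemidef :=
  posSemidef_add_const (fun i => hσ.memLp_comp (memLp_eval_multivariateGaussian M i)) hCb hCW

/-- The summand `0 +` matches the shape of `posSemidef_add_const` and `dotProduct_mulVec_add_const`.
-/
lemma hatCov_covStep :
    hatCov Cb (covStep σ Cb CW M) =
      Matrix.of fun j k => 0 + CW * ∫ g, σ (g j) * σ (g k) ∂(multivariateGaussian 0 M) := by
  ext j k
  simp [hatCov, covStep]

lemma posSemidef_hatCov_covStep (hσ : LipschitzWith c σ) (hCW : 0 ≤ CW) :
    (hatCov Cb (covStep σ Cb CW M)).PosSemidef := by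
  rw [hatCov_covStep]
  exact posSemidef_add_const (fun i => hσ.memLp_comp (memLp_eval_multivariateGaussian M i))
    le_rfl hCW

lemma trace_hatCov_covStep :
    (hatCov Cb (covStep σ Cb CW M)).trace = CW * ∑ j, meanSq σ M j := by
  simp [hatCov_covStep, Matrix.trace, meanSq, Finset.mul_sum, pow_two]

/-- The two forms differ by `Cb * (∑ y j)²`. -/
lemma dotProduct_hatCov_mulVec_le (hCb : 0 ≤ Cb) (K : Matrix (Fin d) (Fin d) ℝ)
    (y : Fin d → ℝ) : y ⬝ᵥ (hatCov Cb K).mulVec y ≤ y ⬝ᵥ K.mulVec y := by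
  have h : y ⬝ᵥ (Matrix.of fun _ _ : Fin d => (1 : ℝ)).mulVec y = (∑ j, y j) ^ 2 := by
    simp [dotProduct, Matrix.mulVec, pow_two, Finset.sum_mul]
  rw [hatCov, Matrix.sub_mulVec, dotProduct_sub, Matrix.smul_mulVec, dotProduct_smul, h,
    smul_eq_mul]
  nlinarith [mul_nonneg hCb (sq_nonneg (∑ j, y j))]

lemma le_dotProduct_hatCov_covStep (hσ : LipschitzWith c σ) (hCW : 0 ≤ CW) (hM : M.PosSemidef)
    (y : Fin d → ℝ) :
    CW * ((fun j => meanDeriv σ M j * y j) ⬝ᵥ M.mulVec (fun j => meanDeriv σ M j * y j)) ≤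
      y ⬝ᵥ (hatCov Cb (covStep σ Cb CW M)).mulVec y := by
  rw [hatCov_covStep, dotProduct_mulVec_add_const
    fun i => hσ.memLp_comp (memLp_eval_multivariateGaussian M i), zero_mul, zero_add]
  exact mul_le_mul_of_nonneg_left (hσ.le_integral_sum_sq hM y) hCW

lemma LipschitzWith.meanSq_le (hσ : LipschitzWith c σ) (hM : M.PosSemidef) (j : Fin d) :
    meanSq σ M j ≤ 2 * σ 0 ^ 2 + 2 * c ^ 2 * M j j := by
  rw [← integral_eval_mul_eval_multivariateGaussian hM j j]
  simp only [← pow_two]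
  exact hσ.integral_sq_le (memLp_eval_multivariateGaussian M j)

end Gaussian

/-- The infimum is attained: every difference quotient is a lower bound of the set of constants. -/
lemma LipschitzWith.lipNorm {c : ℝ≥0} {σ : ℝ → ℝ} (hσ : LipschitzWith c σ) :
    LipschitzWith (lipNorm σ) σ := by
  intro s t
  rw [edist_nndist, edist_nndist, ← ENNReal.coe_mul, ENNReal.coe_le_coe]
  by_cases hst : nndist s t = 0
  · have : s = t := by simpa using hst
    simp [this]
  rw [← div_le_iff₀ (pos_iff_ne_zero.2 hst)]
  refine le_csInf ⟨c, hσ⟩ fun c' hc' => ?_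
  rw [div_le_iff₀ (pos_iff_ne_zero.2 hst)]
  exact LipschitzWith.nndist_le hc' s t

/-! ### Second moments of the first layer. -/

section FirstLayer

/-- The bias acts as one more weight, with index `none` and coefficient 1, so the layer is a single
linear combination of independent variables. -/
lemma firstLayer_eq_sum {Ω : Type*} {n₀ : ℕ} {CW : ℝ} {b : Ω → ℝ} {W : Fin n₀ → Ω → ℝ}
    (x : EuclideanSpace ℝ (Fin n₀)) (ω : Ω) :
    firstLayer CW b W x ω = ∑ o : Option (Fin n₀),
      o.elim 1 (fun k => Real.sqrt CW / Real.sqrt n₀ * x k) * (o.elim b W : Ω → ℝ) ω := by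
  simp only [firstLayer, Fintype.sum_option, Option.elim, one_mul, Finset.mul_sum]
  congr 1
  exact Finset.sum_congr rfl fun k _ => by ring

variable {Ω : Type*} [MeasurableSpace Ω] {P : Measure Ω} {n₀ d : ℕ} {Cb : ℝ≥0} {CW : ℝ}
  {b : Ω → ℝ} {W : Fin n₀ → Ω → ℝ}

lemma memLp_two_of_integral_sq_eq_one {X : Ω → ℝ} (hX : AEMeasurable X P)
    (h : ∫ ω, X ω ^ 2 ∂P = 1) : MemLp X 2 P := by
  -- If the square were not integrable, its integral would be 0 by default, not 1.
  rw [memLp_two_iff_integrable_sq hX.aestronglyMeasurable]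
  by_contra hn
  rw [integral_undef hn] at h
  exact zero_ne_one h

lemma memLp_two_of_hasLaw_gaussianReal (hb : HasLaw b (gaussianReal 0 Cb) P) : MemLp b 2 P :=
  hb.hasGaussianLaw.memLp_two

lemma memLp_elim (hb : HasLaw b (gaussianReal 0 Cb) P)
    (hW : ∀ k, AEMeasurable (W k) P) (hW2 : ∀ k, ∫ ω, W k ω ^ 2 ∂P = 1)
    (o : Option (Fin n₀)) : MemLp (o.elim b W : Ω → ℝ) 2 P := by
  cases o with
  | none => exact memLp_two_of_hasLaw_gaussianReal hb
  | some k => exact memLp_two_of_integral_sq_eq_one (hW k) (hW2 k)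

lemma memLp_firstLayer (hb : HasLaw b (gaussianReal 0 Cb) P)
    (hW : ∀ k, AEMeasurable (W k) P) (hW2 : ∀ k, ∫ ω, W k ω ^ 2 ∂P = 1)
    (x : EuclideanSpace ℝ (Fin n₀)) : MemLp (firstLayer CW b W x) 2 P := by
  have h := memLp_two_sum_mul (memLp_elim hb hW hW2)
    (fun o => o.elim 1 (fun k => Real.sqrt CW / Real.sqrt n₀ * x k))
  rwa [show firstLayer CW b W x = _ from funext fun ω => firstLayer_eq_sum x ω]

lemma integral_firstLayer_sq (hCW : 0 ≤ CW) (hb : HasLaw b (gaussianReal 0 Cb) P)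
    (hW : ∀ k, AEMeasurable (W k) P) (hW1 : ∀ k, ∫ ω, W k ω ∂P = 0)
    (hW2 : ∀ k, ∫ ω, W k ω ^ 2 ∂P = 1)
    (hind : iIndepFun (fun o : Option (Fin n₀) => o.elim b W) P)
    (x : EuclideanSpace ℝ (Fin n₀)) :
    ∫ ω, firstLayer CW b W x ω ^ 2 ∂P = Cb + CW * (‖x‖ ^ 2 / n₀) := by
  have hL := memLp_elim hb hW hW2
  have hb0 : ∫ ω, b ω ∂P = 0 := by
    rw [hb.integral_eq, integral_id_gaussianReal]
  have hb2 : ∫ ω, b ω ^ 2 ∂P = Cb := by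
    have h := hb.variance_eq
    rw [variance_id_gaussianReal, variance_of_integral_eq_zero hb.aemeasurable hb0] at h
    exact h
  have hmean : ∀ o : Option (Fin n₀), ∫ ω, (o.elim b W : Ω → ℝ) ω ∂P = 0 := by
    rintro (_ | k)
    exacts [hb0, hW1 k]
  have hcross : ∀ o o' : Option (Fin n₀), o ≠ o' →
      ∫ ω, (o.elim b W : Ω → ℝ) ω * (o'.elim b W : Ω → ℝ) ω ∂P = 0 := by
    intro o o' h
    rw [(hind.indepFun h).integral_fun_mul_eq_mul_integral (hL o).1 (hL o').1, hmean, zero_mul]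
  simp only [pow_two, firstLayer_eq_sum]
  rw [integral_sum_mul_sum hL hL]
  -- Independence and zero means kill the off-diagonal moments.
  have hdiag : (Matrix.of fun o o' : Option (Fin n₀) =>
      ∫ ω, (o.elim b W : Ω → ℝ) ω * (o'.elim b W : Ω → ℝ) ω ∂P) =
      Matrix.diagonal fun o => o.elim (Cb : ℝ) fun _ => 1 := by
    ext o o'
    by_cases h : o = o'
    · subst h
      rw [Matrix.diagonal_apply_eq, Matrix.of_apply]
      simp only [← pow_two]
      cases o with
      | none => exact hb2
      | some k => exact hW2 k
    · rw [Matrix.diagonal_apply_ne _ h, Matrix.of_apply, hcross o o' h]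
  rw [hdiag]
  simp only [dotProduct, Matrix.mulVec_diagonal, Fintype.sum_option, Option.elim, one_mul, mul_one]
  congr 1
  rw [← pow_two ‖x‖, EuclideanSpace.real_norm_sq_eq, Finset.sum_div, Finset.mul_sum]
  refine Finset.sum_congr rfl fun k _ => ?_
  calc _ = Real.sqrt CW ^ 2 / Real.sqrt n₀ ^ 2 * x k ^ 2 := by ring
    _ = _ := by
      rw [Real.sq_sqrt hCW, Real.sq_sqrt (Nat.cast_nonneg _)]
      ring

end FirstLayer

/-! ### The trace recursion. -/

lemma Matrix.trace_covStep {d : ℕ} (σ : ℝ → ℝ) (Cb CW : ℝ) (M : Matrix (Fin d) (Fin d) ℝ) :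
    (covStep σ Cb CW M).trace = d * Cb + CW * ∑ j, meanSq σ M j := by
  simp [covStep, Matrix.trace, meanSq, Finset.mul_sum, pow_two, Finset.sum_add_distrib]

lemma LipschitzWith.sum_meanSq_le {d : ℕ} {c : ℝ≥0} {σ : ℝ → ℝ} (hσ : LipschitzWith c σ)
    {M : Matrix (Fin d) (Fin d) ℝ} (hM : M.PosSemidef) :
    ∑ j, meanSq σ M j ≤ 2 * d * σ 0 ^ 2 + 2 * c ^ 2 * M.trace := by
  calc ∑ j, meanSq σ M j ≤ ∑ j, (2 * σ 0 ^ 2 + 2 * c ^ 2 * M j j) :=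
        Finset.sum_le_sum fun j _ => hσ.meanSq_le hM j
    _ = _ := by
        simp only [Finset.sum_add_distrib, ← Finset.mul_sum, Matrix.trace, Matrix.diag_apply]
        simp
        ring

/-- A sequence with `u (n + 1) ≤ p + q u n` is bounded by `n` steps of the largest size. -/
lemma le_of_le_add_mul {p q A : ℝ} (hp : 0 ≤ p) (hq : 0 ≤ q) (hA : 0 ≤ A) {u : ℕ → ℝ}
    (h0 : u 0 ≤ p + q * A) (h : ∀ n, u (n + 1) ≤ p + q * u n) (n : ℕ) :
    u n ≤ (1 + q ^ (n + 1)) * ((n + 1) * p + A) := by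
  have key : ∀ n, u n ≤ (∑ i ∈ Finset.range (n + 1), q ^ i) * p + q ^ (n + 1) * A := by
    intro n
    induction n with
    | zero => simpa using h0
    | succ n ih =>
      rw [Finset.sum_range_succ']
      calc u (n + 1) ≤ p + q * u n := h n
        _ ≤ p + q * ((∑ i ∈ Finset.range (n + 1), q ^ i) * p + q ^ (n + 1) * A) := by gcongr
        _ = _ := by
          simp only [pow_succ q, ← Finset.sum_mul]
          ring
  -- Adding 1 covers both cases: powers are at most 1 if `q ≤ 1`, and at most the top power
  -- otherwise.
  have hpow : ∀ i ∈ Finset.range (n + 1), q ^ i ≤ 1 + q ^ (n + 1) := by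
    intro i hi
    rcases le_total q 1 with h1 | h1
    · linarith [pow_le_one₀ hq h1 (n := i), pow_nonneg hq (n + 1)]
    · linarith [pow_le_pow_right₀ h1 (Finset.mem_range.1 hi).le]
  have hsum := Finset.sum_le_card_nsmul _ _ _ hpow
  simp only [Finset.card_range, nsmul_eq_mul, Nat.cast_add, Nat.cast_one] at hsum
  nlinarith [key n, mul_le_mul_of_nonneg_right hsum hp]

/-! ### Iteration over the layers. -/

section Recursion

variable {d : ℕ} {c : ℝ≥0} {σ : ℝ → ℝ} {Cb CW : ℝ} {K : ℕ → Matrix (Fin d) (Fin d) ℝ}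

lemma posSemidef_of_covStep (hσ : LipschitzWith c σ) (hCb : 0 ≤ Cb) (hCW : 0 ≤ CW)
    (h2 : (K 2).PosSemidef) (hK : ∀ n, K (n + 3) = covStep σ Cb CW (K (n + 2))) (n : ℕ) :
    (K (n + 2)).PosSemidef := by
  cases n with
  | zero => exact h2
  | succ n =>
    rw [hK]
    exact posSemidef_covStep hσ hCb hCW

lemma minEigen_nonneg (hd : 0 < d) {M : Matrix (Fin d) (Fin d) ℝ} (hM : M.PosSemidef) :
    0 ≤ minEigen M :=
  le_minEigen hd fun y => by simpa using hM.dotProduct_mulVec_nonneg y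

/-- Each layer multiplies the diagonal lower bound by `CW` and the squared mean derivatives.
Intermediate layers return from the hatted matrix to `K`, which only increases the form; the last
one keeps the hat. -/
lemma sum_prod_meanDeriv_le (hσ : LipschitzWith c σ) (hCb : 0 ≤ Cb) (hCW : 0 ≤ CW)
    (h2 : (K 2).PosSemidef) (hK : ∀ n, K (n + 3) = covStep σ Cb CW (K (n + 2))) (n : ℕ)
    (y : Fin d → ℝ) :
    ∑ i, minEigen (K 2) * CW ^ (n + 1) *
      (∏ m ∈ Finset.range (n + 1), meanDeriv σ (K (m + 2)) i ^ 2) * y i ^ 2 ≤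
      y ⬝ᵥ (hatCov Cb (K (n + 3))).mulVec y := by
  have hpsd := posSemidef_of_covStep hσ hCb hCW h2 hK
  have step : ∀ n, (∀ y : Fin d → ℝ, ∑ i, minEigen (K 2) * CW ^ n *
      (∏ m ∈ Finset.range n, meanDeriv σ (K (m + 2)) i ^ 2) * y i ^ 2 ≤
      y ⬝ᵥ (K (n + 2)).mulVec y) → ∀ y : Fin d → ℝ, ∑ i, minEigen (K 2) * CW ^ (n + 1) *
      (∏ m ∈ Finset.range (n + 1), meanDeriv σ (K (m + 2)) i ^ 2) * y i ^ 2 ≤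
      y ⬝ᵥ (hatCov Cb (K (n + 3))).mulVec y := by
    intro n ih y
    rw [hK]
    refine le_trans ?_ (le_dotProduct_hatCov_covStep hσ hCW (hpsd n) y)
    refine le_trans (le_of_eq ?_) (mul_le_mul_of_nonneg_left (ih _) hCW)
    rw [Finset.mul_sum]
    refine Finset.sum_congr rfl fun i _ => ?_
    rw [Finset.prod_range_succ]
    ring
  have all : ∀ n, ∀ y : Fin d → ℝ, ∑ i, minEigen (K 2) * CW ^ n *
      (∏ m ∈ Finset.range n, meanDeriv σ (K (m + 2)) i ^ 2) * y i ^ 2 ≤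
      y ⬝ᵥ (K (n + 2)).mulVec y := by
    intro n
    induction n with
    | zero =>
      intro y
      refine le_trans (le_of_eq ?_) (minEigen_mul_le (K 2) y)
      simp [dotProduct, Finset.mul_sum, pow_two]
    | succ n ih => exact fun y => (step n ih y).trans (dotProduct_hatCov_mulVec_le hCb _ y)
  exact step n (all n) y

/-- An injection of a finite type into itself is a permutation, so all summands agree. -/
lemma sum_embedding_prod {ι R : Type*} [Fintype ι] [DecidableEq ι] [CommSemiring R] (f : ι → R) :
    ∑ k : ι ↪ ι, ∏ i, f (k i) = (Fintype.card ι).factorial * ∏ i, f i := by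
  have h : ∀ k : ι ↪ ι, ∏ i, f (k i) = ∏ i, f i := fun k =>
    (Finite.injective_iff_bijective.1 k.injective).prod_comp f
  simp [h, Fintype.card_embedding_eq, Nat.descFactorial_self]

lemma detBound_eq_prod (σ : ℝ → ℝ) (CW : ℝ) (K : ℕ → Matrix (Fin d) (Fin d) ℝ) (n : ℕ) :
    detBound σ CW K (n + 3) = ∏ i, minEigen (K 2) * CW ^ (n + 1) *
      ∏ m ∈ Finset.range (n + 1), meanDeriv σ (K (m + 2)) i ^ 2 := by
  have hre : ∀ i, ∏ r ∈ Finset.Icc 1 (n + 3 - 2), meanDeriv σ (K (n + 3 - r)) i ^ 2 =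
      ∏ m ∈ Finset.range (n + 1), meanDeriv σ (K (m + 2)) i ^ 2 := by
    intro i
    -- The substitution `m = n + 1 - r` reverses the order of the layers.
    refine Finset.prod_nbij' (fun r => n + 1 - r) (fun m => n + 1 - m) ?_ ?_ ?_ ?_ ?_
    · intro r hr; simp only [Finset.mem_Icc, Finset.mem_range] at *; omega
    · intro m hm; simp only [Finset.mem_Icc, Finset.mem_range] at *; omega
    · intro r hr; simp only [Finset.mem_Icc] at *; omega
    · intro m hm; simp only [Finset.mem_range] at *; omega
    · intro r hr
      simp only [Finset.mem_Icc] at hr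
      rw [show n + 3 - r = n + 1 - r + 2 by omega]
  have hfac : (d.factorial : ℝ) ≠ 0 := by exact_mod_cast d.factorial_ne_zero
  simp only [detBound, hre]
  rw [sum_embedding_prod fun i => ∏ m ∈ Finset.range (n + 1), meanDeriv σ (K (m + 2)) i ^ 2,
    Fintype.card_fin, Finset.prod_mul_distrib, Finset.prod_const, Finset.card_univ,
    Fintype.card_fin, mul_pow, ← pow_mul, show n + 3 - 2 = n + 1 by omega, mul_comm d]
  field_simp

lemma detBound_nonneg (hd : 0 < d) (hCW : 0 ≤ CW) (h2 : (K 2).PosSemidef) (n : ℕ) :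
    0 ≤ detBound σ CW K (n + 3) := by
  have := minEigen_nonneg hd h2
  rw [detBound_eq_prod]
  exact Finset.prod_nonneg fun i _ => mul_nonneg (by positivity)
    (Finset.prod_nonneg fun m _ => sq_nonneg _)

lemma detBound_le_det_hatCov (hd : 0 < d) (hσ : LipschitzWith c σ) (hCb : 0 ≤ Cb)
    (hCW : 0 ≤ CW) (h2 : (K 2).PosSemidef)
    (hK : ∀ n, K (n + 3) = covStep σ Cb CW (K (n + 2))) (n : ℕ) :
    detBound σ CW K (n + 3) ≤ (hatCov Cb (K (n + 3))).det := by
  have hhat : (hatCov Cb (K (n + 3))).PosSemidef := by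
    rw [hK]
    exact posSemidef_hatCov_covStep hσ hCW
  have hq := sum_prod_meanDeriv_le hσ hCb hCW h2 hK n
  have hl := minEigen_nonneg hd h2
  rw [detBound_eq_prod]
  set f : Fin d → ℝ := fun i => minEigen (K 2) * CW ^ (n + 1) *
    ∏ m ∈ Finset.range (n + 1), meanDeriv σ (K (m + 2)) i ^ 2
  have hf : ∀ i, 0 ≤ f i := fun i => mul_nonneg (by positivity)
    (Finset.prod_nonneg fun m _ => sq_nonneg _)
  change ∏ i, f i ≤ _
  -- `prod_le_det` divides by the diagonal entries; if one vanishes, nonnegativity of the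
  -- determinant is enough.
  by_cases h0 : ∃ i, f i = 0
  · obtain ⟨i, hi⟩ := h0
    rw [Finset.prod_eq_zero (Finset.mem_univ i) hi]
    exact hhat.det_nonneg
  · push Not at h0
    have h := hhat.1.prod_le_det (e := fun i => Real.sqrt (f i))
      (fun i => (Real.sqrt_pos.2 (lt_of_le_of_ne (hf i) (h0 i).symm)).ne') (fun y => by
        simp only [Real.sq_sqrt (hf _)]
        exact hq y)
    simpa only [Real.sq_sqrt (hf _)] using h

/-- `A` stands for the trace of a layer preceding `K 2`, so that `h0` has the form of one more
recursion step. -/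
lemma trace_le_of_covStep (hσ : LipschitzWith c σ) (hCb : 0 ≤ Cb) (hCW : 0 ≤ CW)
    (h2 : (K 2).PosSemidef) (hK : ∀ n, K (n + 3) = covStep σ Cb CW (K (n + 2))) {A : ℝ}
    (hA : 0 ≤ A)
    (h0 : (K 2).trace ≤ d * (Cb + 2 * CW * σ 0 ^ 2) + 2 * CW * c ^ 2 * A) (n : ℕ) :
    (K (n + 2)).trace ≤ (1 + (2 * CW * c ^ 2) ^ (n + 1)) *
      ((n + 1) * (d * (Cb + 2 * CW * σ 0 ^ 2)) + A) := by
  refine le_of_le_add_mul (u := fun n => (K (n + 2)).trace) (by positivity) (by positivity) hA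
    h0 (fun n => ?_) n
  have h := mul_le_mul_of_nonneg_left
    (hσ.sum_meanSq_le (posSemidef_of_covStep hσ hCb hCW h2 hK n)) hCW
  simp only [hK, Matrix.trace_covStep]
  linarith

end Recursion

/-! ### The limiting covariances and the explicit trace bound. -/

section LimitCov

variable {Ω : Type*} [MeasurableSpace Ω] {P : Measure Ω} [IsProbabilityMeasure P] {n₀ d : ℕ}
  {Cb : ℝ≥0} {CW : ℝ} {c : ℝ≥0} {σ : ℝ → ℝ} {b : Ω → ℝ} {W : Fin n₀ → Ω → ℝ}

lemma posSemidef_secondCov (hCW : 0 ≤ CW) (hσ : LipschitzWith c σ)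
    (hb : HasLaw b (gaussianReal 0 Cb) P) (hW : ∀ k, AEMeasurable (W k) P)
    (hW2 : ∀ k, ∫ ω, W k ω ^ 2 ∂P = 1) (x : Fin d → EuclideanSpace ℝ (Fin n₀)) :
    (secondCov P σ Cb CW b W x).PosSemidef :=
  posSemidef_add_const (fun j => hσ.memLp_comp (memLp_firstLayer hb hW hW2 (x j)))
    Cb.coe_nonneg hCW

lemma trace_secondCov_le (hCW : 0 ≤ CW) (hσ : LipschitzWith c σ)
    (hb : HasLaw b (gaussianReal 0 Cb) P) (hW : ∀ k, AEMeasurable (W k) P)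
    (hW1 : ∀ k, ∫ ω, W k ω ∂P = 0) (hW2 : ∀ k, ∫ ω, W k ω ^ 2 ∂P = 1)
    (hind : iIndepFun (fun o : Option (Fin n₀) => o.elim b W) P)
    (x : Fin d → EuclideanSpace ℝ (Fin n₀)) :
    (secondCov P σ Cb CW b W x).trace ≤ d * (Cb + 2 * CW * σ 0 ^ 2) +
      2 * CW * c ^ 2 * (d * Cb + CW * ((∑ j, ‖x j‖ ^ 2) / n₀)) := by
  have h : ∀ j, secondCov P σ Cb CW b W x j j ≤
      Cb + CW * (2 * σ 0 ^ 2 + 2 * c ^ 2 * (Cb + CW * (‖x j‖ ^ 2 / n₀))) := by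
    intro j
    simp only [secondCov, Matrix.of_apply, ← pow_two]
    rw [← integral_firstLayer_sq hCW hb hW hW1 hW2 hind (x j)]
    gcongr
    exact hσ.integral_sq_le (memLp_firstLayer hb hW hW2 (x j))
  calc (secondCov P σ Cb CW b W x).trace
      ≤ ∑ j, (Cb + CW * (2 * σ 0 ^ 2 + 2 * c ^ 2 * (Cb + CW * (‖x j‖ ^ 2 / n₀)))) :=
        Finset.sum_le_sum fun j _ => h j
    _ = _ := by
        simp only [Finset.sum_add_distrib, ← Finset.mul_sum, ← Finset.sum_div, Finset.sum_const,
          Finset.card_univ, Fintype.card_fin, nsmul_eq_mul]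
        ring

lemma sum_meanSq_le_traceBound (hCW : 0 ≤ CW) (hσ : LipschitzWith c σ)
    (hb : HasLaw b (gaussianReal 0 Cb) P) (hW : ∀ k, AEMeasurable (W k) P)
    (hW1 : ∀ k, ∫ ω, W k ω ∂P = 0) (hW2 : ∀ k, ∫ ω, W k ω ^ 2 ∂P = 1)
    (hind : iIndepFun (fun o : Option (Fin n₀) => o.elim b W) P)
    (x : Fin d → EuclideanSpace ℝ (Fin n₀)) (n : ℕ) :
    CW * ∑ j, meanSq σ (limitCov P σ Cb CW b W x (n + 2)) j ≤
      traceBound σ Cb CW x (n + 3) := by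
  have hX : 0 ≤ (∑ j, ‖x j‖ ^ 2) / (n₀ : ℝ) := by positivity
  have h := trace_le_of_covStep (K := limitCov P σ Cb CW b W x) hσ.lipNorm Cb.coe_nonneg hCW
    (posSemidef_secondCov hCW hσ hb hW hW2 x) (fun n => rfl)
    -- This `A` is the trace of the second moment matrix of the first layer at the inputs.
    (A := d * Cb + CW * ((∑ j, ‖x j‖ ^ 2) / n₀)) (by positivity)
    (trace_secondCov_le hCW hσ.lipNorm hb hW hW1 hW2 hind x) (n + 1)
  have htr : (limitCov P σ Cb CW b W x (n + 1 + 2)).trace =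
      d * Cb + CW * ∑ j, meanSq σ (limitCov P σ Cb CW b W x (n + 2)) j :=
    Matrix.trace_covStep σ Cb CW _
  rw [htr] at h
  set X := (∑ j, ‖x j‖ ^ 2) / (n₀ : ℝ)
  have hdCb : 0 ≤ (d : ℝ) * Cb := by positivity
  have hσ0 : 0 ≤ σ 0 ^ 2 := sq_nonneg _
  -- The `n + 2` recursion steps and the `d * Cb` in `A` together account for the factor `ℓ = n +
  -- 3`. One factor `1 + CW` absorbs the constants; the second is slack.
  have hinner : (((n + 1 : ℕ) : ℝ) + 1) * (d * (Cb + 2 * CW * σ 0 ^ 2)) + (d * Cb + CW * X) ≤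
      (1 + CW) ^ 2 * (d * ((n + 3 : ℕ) : ℝ) * (Cb + 2 * σ 0 ^ 2) + X) := by
    push_cast
    have hB : (Cb : ℝ) + 2 * CW * σ 0 ^ 2 ≤ (1 + CW) * (Cb + 2 * σ 0 ^ 2) := by
      nlinarith [mul_nonneg hCW Cb.coe_nonneg]
    have hC : (Cb : ℝ) ≤ (1 + CW) * (Cb + 2 * σ 0 ^ 2) := by
      nlinarith [mul_nonneg hCW Cb.coe_nonneg, mul_nonneg hCW hσ0]
    have hY : 0 ≤ d * ((n : ℝ) + 3) * (Cb + 2 * σ 0 ^ 2) + X := by positivity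
    calc ((n : ℝ) + 1 + 1) * (d * (Cb + 2 * CW * σ 0 ^ 2)) + (d * Cb + CW * X)
        ≤ ((n : ℝ) + 1 + 1) * (d * ((1 + CW) * (Cb + 2 * σ 0 ^ 2))) +
          (d * ((1 + CW) * (Cb + 2 * σ 0 ^ 2)) + (1 + CW) * X) := by
          gcongr
          linarith
      _ = (1 + CW) * (d * ((n : ℝ) + 3) * (Cb + 2 * σ 0 ^ 2) + X) := by ring
      _ ≤ _ := by
          refine mul_le_mul_of_nonneg_right ?_ hY
          nlinarith
  rw [traceBound, sq_abs, show n + 3 - 1 = n + 1 + 1 by omega]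
  calc CW * ∑ j, meanSq σ (limitCov P σ Cb CW b W x (n + 2)) j
      ≤ d * Cb + CW * ∑ j, meanSq σ (limitCov P σ Cb CW b W x (n + 2)) j := by linarith
    _ ≤ _ := h
    _ ≤ _ := mul_le_mul_of_nonneg_left hinner (by positivity)
    _ = _ := by ring

end LimitCov

/-! ### Assembly of the bounds. -/

theorem mainTheorem5
    {Ω : Type*} [MeasurableSpace Ω] (P : Measure Ω) [IsProbabilityMeasure P]
    (n₀ d : ℕ) (hn₀ : 0 < n₀) (hd : 0 < d)
    (Cb : ℝ≥0) (CW : ℝ) (hCW : 0 < CW)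
    (σ : ℝ → ℝ) (hσ : ∃ c : ℝ≥0, LipschitzWith c σ)
    -- first-layer bias and weights
    (b : Ω → ℝ) (W : Fin n₀ → Ω → ℝ)
    (hb : HasLaw b (gaussianReal 0 Cb) P)
    (hW : ∀ k, AEMeasurable (W k) P)
    (hWid : ∀ k k', IdentDistrib (W k) (W k') P P)
    (hW1 : ∀ k, ∫ ω, W k ω ∂P = 0)
    (hW2 : ∀ k, ∫ ω, W k ω ^ 2 ∂P = 1)
    (hind : iIndepFun (fun o : Option (Fin n₀) => o.elim b W) P)
    (x : Fin d → EuclideanSpace ℝ (Fin n₀))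
    -- the limiting covariance matrices
    (K : ℕ → Matrix (Fin d) (Fin d) ℝ) (hK : K = limitCov P σ Cb CW b W x)
    (ℓ : ℕ) (hℓ : 3 ≤ ℓ) :
    -- lower bound on the determinant
    detBound σ CW K ℓ ≤ (hatCov Cb (K ℓ)).det ∧
    -- lower bounds on the smallest eigenvalue
    detBound σ CW K ℓ ≤
      (CW * ∑ j, meanSq σ (K (ℓ - 1)) j) ^ (d - 1) * minEigen (K ℓ) ∧
    detBound σ CW K ℓ ≤ traceBound σ Cb CW x ℓ ^ (d - 1) * minEigen (K ℓ) ∧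
    -- the same for the inverse of the smallest eigenvalue, in the nondegenerate case
    (0 < minEigen (K 2) →
      (∀ m ∈ Finset.Icc 2 (ℓ - 1), ∀ k, meanDeriv σ (K m) k ≠ 0) →
      0 < detBound σ CW K ℓ ∧
      0 < minEigen (hatCov Cb (K ℓ)) ∧
      minEigen (hatCov Cb (K ℓ)) ≤ minEigen (K ℓ) ∧
      (minEigen (K ℓ))⁻¹ ≤ (minEigen (hatCov Cb (K ℓ)))⁻¹ ∧
      (minEigen (hatCov Cb (K ℓ)))⁻¹ ≤
        (hatCov Cb (K ℓ)).trace ^ (d - 1) / (hatCov Cb (K ℓ)).det ∧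
      (hatCov Cb (K ℓ)).trace ^ (d - 1) / (hatCov Cb (K ℓ)).det ≤
        (CW * ∑ j, meanSq σ (K (ℓ - 1)) j) ^ (d - 1) / detBound σ CW K ℓ ∧
      (CW * ∑ j, meanSq σ (K (ℓ - 1)) j) ^ (d - 1) / detBound σ CW K ℓ ≤
        traceBound σ Cb CW x ℓ ^ (d - 1) / detBound σ CW K ℓ) := by
  obtain ⟨c, hσ⟩ := hσ
  obtain ⟨n, rfl⟩ : ∃ n, ℓ = n + 3 := ⟨ℓ - 3, by omega⟩
  have h2 : (K 2).PosSemidef := by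
    rw [hK]
    exact posSemidef_secondCov hCW.le hσ hb hW hW2 x
  have hstep : ∀ n, K (n + 3) = covStep σ Cb CW (K (n + 2)) := by
    intro n
    rw [hK]
    rfl
  have hhat : (hatCov Cb (K (n + 3))).PosSemidef := by
    rw [hstep]
    exact posSemidef_hatCov_covStep hσ hCW.le
  have hdet := detBound_le_det_hatCov hd hσ Cb.coe_nonneg hCW.le h2 hstep n
  have hD := detBound_nonneg (σ := σ) hd hCW.le h2 n
  have htr : (hatCov Cb (K (n + 3))).trace = CW * ∑ j, meanSq σ (K (n + 2)) j := by
    rw [hstep, trace_hatCov_covStep]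
  have hST : CW * ∑ j, meanSq σ (K (n + 2)) j ≤ traceBound σ Cb CW x (n + 3) := by
    rw [hK]
    exact sum_meanSq_le_traceBound hCW.le hσ hb hW hW1 hW2 hind x n
  have hS : 0 ≤ CW * ∑ j, meanSq σ (K (n + 2)) j := htr ▸ hhat.trace_nonneg
  have hSTpow := pow_le_pow_left₀ hS hST (d - 1)
  have hlhat : 0 ≤ minEigen (hatCov Cb (K (n + 3))) := minEigen_nonneg hd hhat
  have hll : minEigen (hatCov Cb (K (n + 3))) ≤ minEigen (K (n + 3)) :=
    le_minEigen hd fun y => (minEigen_mul_le _ y).trans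
      (dotProduct_hatCov_mulVec_le Cb.coe_nonneg _ y)
  have hdl := hhat.det_le_trace_pow_mul_minEigen hd
  have hbS : detBound σ CW K (n + 3) ≤
      (CW * ∑ j, meanSq σ (K (n + 2)) j) ^ (d - 1) * minEigen (K (n + 3)) := by
    rw [← htr]
    exact (hdet.trans hdl).trans (mul_le_mul_of_nonneg_left hll
      (pow_nonneg (htr ▸ hS) _))
  refine ⟨hdet, hbS, hbS.trans (mul_le_mul_of_nonneg_right hSTpow (hlhat.trans hll)), ?_⟩
  intro hl hm
  have hDpos : 0 < detBound σ CW K (n + 3) := by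
    rw [detBound_eq_prod]
    refine Finset.prod_pos fun i _ => mul_pos (by positivity) (Finset.prod_pos fun m hmem => ?_)
    rw [Finset.mem_range] at hmem
    exact sq_pos_of_ne_zero (hm (m + 2) (Finset.mem_Icc.2 ⟨by omega, by omega⟩) i)
  have hdetpos := hDpos.trans_le hdet
  -- If the eigenvalue were 0, the trace bound would force the positive determinant to be at most 0.
  have hlhatpos : 0 < minEigen (hatCov Cb (K (n + 3))) := by
    refine lt_of_le_of_ne hlhat fun h => ?_
    rw [← h, mul_zero] at hdl
    exact absurd hdl (not_le.2 hdetpos)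
  refine ⟨hDpos, hlhatpos, hll, inv_anti₀ hlhatpos hll, ?_, ?_, ?_⟩
  · rw [le_div_iff₀ hdetpos, inv_mul_le_iff₀ hlhatpos, mul_comm]
    exact hdl
  · rw [htr]
    exact div_le_div_of_nonneg_left (pow_nonneg hS _) hDpos hdet
  · exact div_le_div_of_nonneg_right hSTpow hDpos.le
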